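/- Theorem. Let $0\le m\le n$ be integers and let $G_0,G_1,G_2,G_3$ be random real $m\times n$ matrices on a probability space, all $4mn$ of whose entries are mutually independent with the standard normal distribution $N(0,1)$. Let ${\bf G}=G_0+G_1{\bf i}+G_2{\bf j}+G_3{\bf k}$ be the resulting random $m\times n$ quaternion matrix, let ${\bf G}^\dagger$ denote its Moore–Penrose pseudoinverse (the unique $n\times m$ quaternion matrix ${\bf X}$ such that ${\bf G}{\bf X}{\bf G}={\bf G}$, ${\bf X}{\bf G}{\bf X}={\bf X}$, and ${\bf G}{\bf X}$ and ${\bf X}{\bf G}$ are Hermitian), and let $\|{\bf A}\|_F=\big(\sum_{i,j}|{\bf a}_{ij}|^2\big)^{1/2}$ denote the Frobenius norm of a quaternion matrix ${\bf A}=[{\bf a}_{ij}]$. Then $\|{\bf G}^\dagger\|_F^2$ is integrable and $$ {\sf E}\,\|{\bf G}^\dagger\|_F^2=\frac{m}{4(n-m)+2}. $$ -/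

import Mathlib

open MeasureTheory ProbabilityTheory
open scoped Matrix Quaternion Matrix.Norms.Frobenius

/-- `X` is a Moore–Penrose inverse of the quaternion matrix `A`: the four Penrose equations. -/
structure IsMoorePenrose {m n : Type*} [Fintype m] [Fintype n]
    (A : Matrix m n ℍ) (X : Matrix n m ℍ) : Prop where
  mul_mul_self : A * X * A = A
  self_mul_mul : X * A * X = X
  left_hermitian : (A * X)ᴴ = A * X
  right_hermitian : (X * A)ᴴ = X * A

theorem quat_eq_zero_of_mul_conjTranspose {m n : Type*} [Fintype m] [Fintype n]
    (A : Matrix m n ℍ) (h : A * Aᴴ = 0) : A = 0 := by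
  ext1 i j
  have h1 : (∑ k, A i k * star (A i k)) = 0 := by
    have := congrFun (congrFun h i) i
    simpa [Matrix.mul_apply] using this
  have h2 : ∑ k, Quaternion.normSq (A i k) = 0 := by
    simp only [Quaternion.self_mul_star] at h1
    have h3 : ((∑ k, Quaternion.normSq (A i k) : ℝ) : ℍ) = 0 := by
      rw [← h1]
      exact map_sum (algebraMap ℝ ℍ) _ _
    exact Quaternion.coe_injective (by rw [h3, Quaternion.coe_zero])
  rw [Finset.sum_eq_zero_iff_of_nonneg (fun _ _ => Quaternion.normSq_nonneg)] at h2
  exact Quaternion.normSq_eq_zero.1 (h2 j (Finset.mem_univ j))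

theorem quat_eq_zero_of_conjTranspose_mul {m n : Type*} [Fintype m] [Fintype n]
    (A : Matrix m n ℍ) (h : Aᴴ * A = 0) : A = 0 := by
  have := quat_eq_zero_of_mul_conjTranspose Aᴴ (by simpa using h)
  simpa using this

theorem IsMoorePenrose.unique {m n : Type*} [Fintype m] [Fintype n]
    {A : Matrix m n ℍ} {X Y : Matrix n m ℍ}
    (hX : IsMoorePenrose A X) (hY : IsMoorePenrose A Y) : X = Y := by
  have h1 : A * X = A * Y := by
    calc A * X = (A * X)ᴴ := hX.left_hermitian.symm
      _ = ((A * Y) * (A * X))ᴴ := by rw [← Matrix.mul_assoc (A * Y), hY.mul_mul_self]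
      _ = (A * X) * (A * Y) := by
        rw [Matrix.conjTranspose_mul, hX.left_hermitian, hY.left_hermitian]
      _ = A * Y := by rw [← Matrix.mul_assoc (A * X), hX.mul_mul_self]
  have h2 : X * A = Y * A := by
    calc X * A = (X * A)ᴴ := hX.right_hermitian.symm
      _ = ((X * A) * (Y * A))ᴴ := by
        rw [Matrix.mul_assoc X A, ← Matrix.mul_assoc A Y, hY.mul_mul_self]
      _ = (Y * A) * (X * A) := by
        rw [Matrix.conjTranspose_mul, hX.right_hermitian, hY.right_hermitian]
      _ = Y * A := by rw [Matrix.mul_assoc Y A, ← Matrix.mul_assoc A X, hX.mul_mul_self]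
  calc X = X * A * X := hX.self_mul_mul.symm
    _ = Y * (A * X) := by rw [h2, Matrix.mul_assoc]
    _ = Y := by rw [h1, ← Matrix.mul_assoc, hY.self_mul_mul]

/-- A Hermitian quaternion matrix has a commuting inner inverse. -/
theorem quat_exists_commute_inner_inverse {m : Type*} [Fintype m] [DecidableEq m]
    (B : Matrix m m ℍ) (hB : Bᴴ = B) :
    ∃ S : Matrix m m ℍ, S * B = B * S ∧ B * S * B = B := by
  have hpow : ∀ k : ℕ, ∀ Y : Matrix m m ℍ, B ^ (k + 1) * Y = 0 → B * Y = 0 := by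
    intro k
    induction k with
    | zero => intro Y h; simpa using h
    | succ k ih =>
      intro Y h
      apply ih
      apply quat_eq_zero_of_conjTranspose_mul
      rw [Matrix.conjTranspose_mul, Matrix.conjTranspose_pow, hB, Matrix.mul_assoc,
        ← Matrix.mul_assoc (B ^ (k + 1)), ← pow_add,
        show k + 1 + (k + 1) = k + (k + 1 + 1) by omega, pow_add, Matrix.mul_assoc, h]
      simp
  obtain ⟨p, hp0, hp⟩ : ∃ p : Polynomial ℝ, p ≠ 0 ∧ Polynomial.aeval B p = 0 :=
    ⟨minpoly ℝ B, minpoly.ne_zero (Algebra.IsIntegral.isIntegral B), minpoly.aeval ℝ B⟩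
  obtain ⟨q, hpq, hq⟩ := Polynomial.exists_eq_pow_rootMultiplicity_mul_and_not_dvd p hp0 0
  simp only [map_zero, sub_zero] at hpq hq
  have hc : q.coeff 0 ≠ 0 := fun h => hq (Polynomial.X_dvd_iff.2 h)
  have hBq : B * Polynomial.aeval B q = 0 := by
    apply hpow (Polynomial.rootMultiplicity 0 p)
    rw [hpq] at hp
    simp only [map_mul, map_pow, Polynomial.aeval_X] at hp
    rw [pow_succ', mul_assoc, hp, mul_zero]
  have hcomm : Commute B (Polynomial.aeval B q.divX) := by
    have := Polynomial.aeval_X (R := ℝ) B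
    exact (Commute.all (Polynomial.X : Polynomial ℝ) q.divX).map (Polynomial.aeval B) |> fun h => by
      simpa using h
  refine ⟨(-(q.coeff 0)⁻¹ : ℝ) • Polynomial.aeval B q.divX, ?_, ?_⟩
  · rw [smul_mul_assoc, mul_smul_comm, hcomm.eq]
  · rw [mul_smul_comm, smul_mul_assoc]
    rw [← Polynomial.divX_mul_X_add q] at hBq
    simp only [map_add, map_mul, Polynomial.aeval_X, Polynomial.aeval_C, mul_add] at hBq
    have h3 : B * Polynomial.aeval B q.divX * B = -(q.coeff 0 • B) := by
      rw [mul_assoc, eq_neg_iff_add_eq_zero]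
      rw [← hBq, Algebra.algebraMap_eq_smul_one, mul_smul_comm, mul_one]
    rw [h3, smul_neg, neg_smul, neg_neg, smul_smul, inv_mul_cancel₀ hc, one_smul]

theorem exists_isMoorePenrose {m n : Type*} [Fintype m] [Fintype n] (A : Matrix m n ℍ) :
    ∃ X : Matrix n m ℍ, IsMoorePenrose A X := by
  classical
  have hB : (A * Aᴴ)ᴴ = A * Aᴴ := by simp
  obtain ⟨S, hS, hBSB⟩ := quat_exists_commute_inner_inverse (A * Aᴴ) hB
  generalize hBdef : A * Aᴴ = B at hB hS hBSB
  have hS' : B * Sᴴ = Sᴴ * B := by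
    have := congrArg Matrix.conjTranspose hS
    simpa [Matrix.conjTranspose_mul, hB] using this
  have hBSB' : B * Sᴴ * B = B := by
    have := congrArg Matrix.conjTranspose hBSB
    simpa [Matrix.conjTranspose_mul, hB, Matrix.mul_assoc] using this
  -- replace the inner inverse by a Hermitian one
  obtain ⟨T, hT, hTc, hBTB⟩ : ∃ T : Matrix m m ℍ, Tᴴ = T ∧ T * B = B * T ∧ B * T * B = B := by
    refine ⟨S * B * Sᴴ, ?_, ?_, ?_⟩
    · simp [Matrix.conjTranspose_mul, hB, Matrix.mul_assoc]
    · rw [Matrix.mul_assoc (S * B), ← hS', ← Matrix.mul_assoc, ← Matrix.mul_assoc,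
        ← Matrix.mul_assoc, hS]
    · rw [← Matrix.mul_assoc, ← Matrix.mul_assoc, hBSB, hBSB']
  have hBTA : B * T * A = A := by
    have h0 : B * T * A - A = 0 := by
      apply quat_eq_zero_of_mul_conjTranspose
      have h1 : (B * T * A - A) * Aᴴ = 0 := by
        rw [Matrix.sub_mul, Matrix.mul_assoc (B * T), hBdef, hBTB, sub_self]
      rw [Matrix.conjTranspose_sub, Matrix.conjTranspose_mul, Matrix.mul_sub,
        ← Matrix.mul_assoc, h1]
      simp
    exact sub_eq_zero.1 h0
  have hATB : Aᴴ * T * B = Aᴴ := by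
    have := congrArg Matrix.conjTranspose hBTA
    simpa [Matrix.conjTranspose_mul, hB, hT, Matrix.mul_assoc] using this
  refine ⟨Aᴴ * T, ?_, ?_, ?_, ?_⟩
  · rw [← Matrix.mul_assoc, hBdef, hBTA]
  · rw [Matrix.mul_assoc (Aᴴ * T), ← Matrix.mul_assoc A, hBdef, ← Matrix.mul_assoc, hATB]
  · rw [← Matrix.mul_assoc, hBdef, Matrix.conjTranspose_mul, hB, hT, hTc]
  · simp [Matrix.conjTranspose_mul, hT, Matrix.mul_assoc]

/-- The Moore–Penrose pseudoinverse of a quaternion matrix. -/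
noncomputable def quatPinv {m n : Type*} [Fintype m] [Fintype n]
    (A : Matrix m n ℍ) : Matrix n m ℍ :=
  Classical.choose (exists_isMoorePenrose A)

theorem quatPinv_isMoorePenrose {m n : Type*} [Fintype m] [Fintype n] (A : Matrix m n ℍ) :
    IsMoorePenrose A (quatPinv A) :=
  Classical.choose_spec (exists_isMoorePenrose A)

/-- The quaternion matrix `G 0 + G 1 i + G 2 j + G 3 k` with four given real parts. -/
def quatMatrix {m n : Type*} (G : Fin 4 → Matrix m n ℝ) : Matrix m n ℍ :=
  Matrix.of fun i j => (⟨G 0 i j, G 1 i j, G 2 i j, G 3 i j⟩ : ℍ)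

/-! If the rows of `G` are left independent, then `G * G† = 1`, and column `i` of `G†` has norm `1 /
d i`, where `d i` is the distance from row `i` to the left span of the other rows
(`rowDist_eq_inv_enorm_column`). Hence `‖G†‖² = ∑ d i ^ (-2)`.

Fix the other rows. Almost surely their span has real dimension `4(m-1)`, so row `i` projects to a
standard Gaussian vector on a space of real dimension `d = 4(n-m)+4`, and `d i` is the norm of that
projection. A standard Gaussian in dimension `d > 2` has inverse square moment `1/(d-2)`, here
`1/(4(n-m)+2)`; the `m` terms add up. Working with `ℝ≥0∞`-valued integrals gives integrability too,
and finiteness of these moments already forces independence of the rows almost surely. -/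

/-! ### Inverse square moments of real Gaussian vectors -/

theorem integral_exp_neg_mul_sq_gaussianReal {t : ℝ} (ht : 0 ≤ t) :
    ∫ x, Real.exp (-t * x ^ 2) ∂gaussianReal 0 1 = (√(1 + 2 * t))⁻¹ := by
  rw [integral_gaussianReal_eq_integral_smul one_ne_zero]
  have h : ∀ x : ℝ, gaussianPDFReal 0 1 x • Real.exp (-t * x ^ 2) =
      (√(2 * Real.pi))⁻¹ * Real.exp (-(t + 1 / 2) * x ^ 2) := by
    intro x
    rw [gaussianPDFReal_def]
    simp only [NNReal.coe_one, mul_one, sub_zero, smul_eq_mul, mul_assoc, ← Real.exp_add]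
    congr 2
    ring
  simp_rw [h]
  rw [integral_const_mul, integral_gaussian, ← Real.sqrt_inv, ← Real.sqrt_inv,
    ← Real.sqrt_mul (by positivity)]
  congr 1
  have := Real.pi_pos
  field_simp
  ring

theorem infEDist_submodule_eq_enorm {E : Type*} [NormedAddCommGroup E]
    [InnerProductSpace ℝ E] [FiniteDimensional ℝ E] (W : Submodule ℝ E) (x : E) :
    Metric.infEDist x (W : Set E) = ‖Wᗮ.orthogonalProjectionOnto x‖ₑ := by
  have h1 : ‖Wᗮ.orthogonalProjectionOnto x‖ₑ = edist x (W.starProjection x) := by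
    rw [edist_eq_enorm_sub]
    have : ‖Wᗮ.orthogonalProjectionOnto x‖ₑ = ‖Wᗮ.starProjection x‖ₑ := rfl
    rw [this, Submodule.starProjection_orthogonal]
    simp
  rw [h1]
  apply le_antisymm
  · exact Metric.infEDist_le_edist_of_mem (W.starProjection_apply_mem x)
  · refine Metric.le_infEDist.2 fun y hy => ?_
    rw [edist_dist, edist_dist, dist_eq_norm, dist_eq_norm, Submodule.starProjection_minimal]
    exact ENNReal.ofReal_le_ofReal (ciInf_le ⟨0, by rintro _ ⟨z, rfl⟩; positivity⟩ (⟨y, hy⟩ : W))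

section Gaussian

variable {E : Type*} [NormedAddCommGroup E] [InnerProductSpace ℝ E] [FiniteDimensional ℝ E]
  [MeasurableSpace E] [BorelSpace E]

theorem integral_exp_neg_mul_norm_sq_stdGaussian {t : ℝ} (ht : 0 ≤ t) :
    ∫ x, Real.exp (-t * ‖x‖ ^ 2) ∂stdGaussian E =
      (√(1 + 2 * t))⁻¹ ^ Module.finrank ℝ E := by
  rw [stdGaussian, integral_map (Measurable.aemeasurable (by fun_prop))
    (Measurable.aestronglyMeasurable (by fun_prop))]
  have h : ∀ x : Fin (Module.finrank ℝ E) → ℝ,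
      Real.exp (-t * ‖∑ i, x i • stdOrthonormalBasis ℝ E i‖ ^ 2) =
        ∏ i, Real.exp (-t * x i ^ 2) := by
    intro x
    rw [← Real.exp_sum, ← Finset.mul_sum, ← (stdOrthonormalBasis ℝ E).sum_sq_norm_inner_right]
    simp [(stdOrthonormalBasis ℝ E).orthonormal.inner_right_fintype]
  simp_rw [h]
  rw [integral_fintype_prod_eq_prod (f := fun _ (y : ℝ) => Real.exp (-t * y ^ 2))]
  simp_rw [integral_exp_neg_mul_sq_gaussianReal ht]
  simp

theorem lintegral_exp_neg_mul_norm_sq_stdGaussian {t : ℝ} (ht : 0 ≤ t) :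
    ∫⁻ x, ENNReal.ofReal (Real.exp (-t * ‖x‖ ^ 2)) ∂stdGaussian E =
      ENNReal.ofReal ((1 + 2 * t) ^ (-(Module.finrank ℝ E : ℝ) / 2)) := by
  rw [← ofReal_integral_eq_lintegral_ofReal, integral_exp_neg_mul_norm_sq_stdGaussian ht]
  · congr 1
    rw [← Real.sqrt_inv, Real.sqrt_eq_rpow, ← Real.rpow_natCast, ← Real.rpow_mul (by positivity),
      Real.inv_rpow (by positivity), ← Real.rpow_neg (by positivity)]
    congr 1
    ring
  · refine Integrable.of_bound (Measurable.aestronglyMeasurable (by fun_prop)) 1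
      (Filter.Eventually.of_forall fun x => ?_)
    rw [Real.norm_eq_abs, Real.abs_exp, Real.exp_le_one_iff]
    have := mul_nonneg ht (sq_nonneg ‖x‖)
    linarith
  · exact Filter.Eventually.of_forall fun x => (Real.exp_pos _).le

theorem lintegral_Ioi_exp_neg_mul {a : ℝ} (ha : 0 ≤ a) :
    ∫⁻ t in Set.Ioi (0 : ℝ), ENNReal.ofReal (Real.exp (-t * a)) = (ENNReal.ofReal a)⁻¹ := by
  -- At `a = 0` both sides are `⊤`, so the identity needs no exception at the origin.
  rcases ha.eq_or_lt with rfl | ha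
  · simp
  · have h : ∀ t : ℝ, Real.exp (-t * a) = Real.exp (-a * t) := fun t => by ring_nf
    simp_rw [h]
    rw [← ofReal_integral_eq_lintegral_ofReal (integrableOn_exp_mul_Ioi (neg_lt_zero.2 ha) 0)
      (Filter.Eventually.of_forall fun x => (Real.exp_pos _).le),
      integral_exp_mul_Ioi (neg_lt_zero.2 ha), ← ENNReal.ofReal_inv_of_pos ha]
    simp

theorem lintegral_Ioi_one_add_two_mul_rpow {d : ℝ} (hd : 2 < d) :
    ∫⁻ t in Set.Ioi (0 : ℝ), ENNReal.ofReal ((1 + 2 * t) ^ (-d / 2)) =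
      ENNReal.ofReal (1 / (d - 2)) := by
  have hder : ∀ t ∈ Set.Ici (0 : ℝ), HasDerivAt
      (fun t : ℝ => -(1 / (d - 2)) * (1 + 2 * t) ^ (1 - d / 2)) ((1 + 2 * t) ^ (-d / 2)) t := by
    intro t ht
    have ht : 0 ≤ t := ht
    have h1 : HasDerivAt (fun t : ℝ => 1 + 2 * t) 2 t := by
      simpa using ((hasDerivAt_id t).const_mul 2).const_add 1
    have h2 := (h1.rpow_const (p := 1 - d / 2) (Or.inl (by positivity))).const_mul (-(1 / (d - 2)))
    refine h2.congr_deriv ?_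
    rw [show 1 - d / 2 - 1 = -d / 2 by ring]
    have : d - 2 ≠ 0 := by linarith
    field_simp
    ring
  have hnn : ∀ t ∈ Set.Ioi (0 : ℝ), 0 ≤ (1 + 2 * t) ^ (-d / 2) := by
    intro t ht
    have ht : 0 < t := ht
    positivity
  have hlim : Filter.Tendsto (fun t : ℝ => -(1 / (d - 2)) * (1 + 2 * t) ^ (1 - d / 2))
      Filter.atTop (nhds 0) := by
    have h1 : Filter.Tendsto (fun t : ℝ => 1 + 2 * t) Filter.atTop Filter.atTop :=
      Filter.tendsto_atTop_add_const_left _ _ (Filter.tendsto_id.const_mul_atTop two_pos)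
    have h2 := (tendsto_rpow_neg_atTop (y := d / 2 - 1) (by linarith)).comp h1
    have h3 := h2.const_mul (-(1 / (d - 2)))
    simpa using h3
  have hc := (hder 0 Set.self_mem_Ici).continuousAt.continuousWithinAt (s := Set.Ici 0)
  have hd' : ∀ t ∈ Set.Ioi (0 : ℝ), HasDerivAt
      (fun t : ℝ => -(1 / (d - 2)) * (1 + 2 * t) ^ (1 - d / 2)) ((1 + 2 * t) ^ (-d / 2)) t :=
    fun t ht => hder t (Set.Ioi_subset_Ici_self ht)
  rw [← ofReal_integral_eq_lintegral_ofReal (integrableOn_Ioi_deriv_of_nonneg hc hd' hnn hlim)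
    ((ae_restrict_iff' measurableSet_Ioi).2 (Filter.Eventually.of_forall hnn)),
    integral_Ioi_of_hasDerivAt_of_nonneg hc hd' hnn hlim]
  simp

/-- Write `1/‖x‖²` as `∫ exp (-t‖x‖²) dt` over `t > 0` and swap by Tonelli: the Gaussian integral
leaves `(1+2t)^(-d/2)`, integrable at infinity exactly when `d > 2`. -/
theorem lintegral_inv_norm_sq_stdGaussian (hd : 3 ≤ Module.finrank ℝ E) :
    ∫⁻ x, (‖x‖ₑ ^ 2)⁻¹ ∂stdGaussian E =
      ENNReal.ofReal (1 / ((Module.finrank ℝ E : ℝ) - 2)) := by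
  have h : ∀ x : E, (‖x‖ₑ ^ 2)⁻¹ =
      ∫⁻ t in Set.Ioi (0 : ℝ), ENNReal.ofReal (Real.exp (-t * ‖x‖ ^ 2)) := by
    intro x
    rw [lintegral_Ioi_exp_neg_mul (sq_nonneg _), ENNReal.ofReal_pow (norm_nonneg _),
      ofReal_norm]
  simp_rw [h]
  rw [lintegral_lintegral_swap (Measurable.aemeasurable (by unfold Function.uncurry; fun_prop)),
    ← lintegral_Ioi_one_add_two_mul_rpow (by
      have : (3 : ℝ) ≤ Module.finrank ℝ E := by exact_mod_cast hd
      linarith)]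
  exact setLIntegral_congr_fun measurableSet_Ioi fun t ht =>
    lintegral_exp_neg_mul_norm_sq_stdGaussian (le_of_lt ht)

theorem stdGaussian_map_orthogonalProjectionOnto (K : Submodule ℝ E) :
    (stdGaussian E).map K.orthogonalProjectionOnto = stdGaussian K := by
  have : IsProbabilityMeasure ((stdGaussian E).map K.orthogonalProjectionOnto) :=
    Measure.isProbabilityMeasure_map (by fun_prop)
  apply Measure.ext_of_charFun
  ext t
  rw [charFun_stdGaussian, charFun_apply, integral_map (by fun_prop)
    (Measurable.aestronglyMeasurable (by fun_prop))]
  simp_rw [Submodule.inner_orthogonalProjectionOnto_eq_of_mem_right]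
  rw [← charFun_apply, charFun_stdGaussian]
  simp

theorem lintegral_inv_infEDist_sq_stdGaussian (W : Submodule ℝ E)
    (hd : Module.finrank ℝ W + 3 ≤ Module.finrank ℝ E) :
    ∫⁻ x, (Metric.infEDist x (W : Set E) ^ 2)⁻¹ ∂stdGaussian E =
      ENNReal.ofReal (1 / ((Module.finrank ℝ E : ℝ) - Module.finrank ℝ W - 2)) := by
  have h := W.finrank_add_finrank_orthogonal
  simp_rw [infEDist_submodule_eq_enorm]
  have h2 := lintegral_inv_norm_sq_stdGaussian (E := Wᗮ) (by omega)
  rw [← stdGaussian_map_orthogonalProjectionOnto, lintegral_map (by fun_prop) (by fun_prop)] at h2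
  rw [h2, ← h]
  push_cast
  congr 3
  ring

end Gaussian

/-! ### Quaternion rows as independent real Gaussian vectors -/

noncomputable instance Quaternion.instMeasurableSpaceReal : MeasurableSpace ℍ := borel ℍ

instance Quaternion.instBorelSpaceReal : BorelSpace ℍ := ⟨rfl⟩

instance Quaternion.instFiniteDimensionalReal : FiniteDimensional ℝ ℍ :=
  inferInstanceAs (Module.Finite ℝ (QuaternionAlgebra ℝ (-1) 0 (-1)))

/-- Row vectors of `n` quaternions with the Euclidean norm. -/
abbrev QuatRow (n : ℕ) : Type := PiLp 2 (fun _ : Fin n => ℍ)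

theorem finrank_quatRow (n : ℕ) : Module.finrank ℝ (QuatRow n) = 4 * n := by
  rw [LinearEquiv.finrank_eq (WithLp.linearEquiv 2 ℝ (Fin n → ℍ)), Module.finrank_pi_fintype]
  simp [Quaternion.finrank_eq_four, mul_comm]

/-- The identification of `4mn` real entries with the `m` rows of an `m × n` quaternion matrix. -/
noncomputable def realEntriesEquivRows (m n : ℕ) :
    EuclideanSpace ℝ (Fin 4 × Fin m × Fin n) ≃ₗᵢ[ℝ] PiLp 2 (fun _ : Fin m => QuatRow n) where
  toFun x := WithLp.toLp 2 fun i => WithLp.toLp 2 fun j =>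
    (⟨x (0, i, j), x (1, i, j), x (2, i, j), x (3, i, j)⟩ : ℍ)
  invFun y := WithLp.toLp 2 fun k =>
    ![(y k.2.1 k.2.2).re, (y k.2.1 k.2.2).imI, (y k.2.1 k.2.2).imJ, (y k.2.1 k.2.2).imK] k.1
  map_add' x y := by
    ext i j <;> rfl
  map_smul' c x := by
    ext i j <;> rfl
  left_inv x := by
    ext ⟨c, i, j⟩
    fin_cases c <;> simp
  right_inv y := by
    ext i j <;> simp
  norm_map' x := by
    refine (sq_eq_sq₀ (norm_nonneg _) (norm_nonneg _)).1 ?_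
    have h : ∀ q : ℍ, ‖q‖ ^ 2 = q.re ^ 2 + q.imI ^ 2 + q.imJ ^ 2 + q.imK ^ 2 := fun q => by
      rw [sq, ← Quaternion.normSq_eq_norm_mul_self, Quaternion.normSq_def']
    rw [EuclideanSpace.real_norm_sq_eq, PiLp.norm_sq_eq_of_L2]
    simp_rw [PiLp.norm_sq_eq_of_L2]
    refine (Finset.sum_congr rfl fun i _ => Finset.sum_congr rfl fun j _ => h _).trans ?_
    simp only [Fintype.sum_prod_type, Fin.sum_univ_four, Finset.sum_add_distrib]
    rfl

theorem map_pi_stdGaussian {ι : Type*} [Fintype ι] {E : Type*} [NormedAddCommGroup E]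
    [InnerProductSpace ℝ E] [FiniteDimensional ℝ E] [MeasurableSpace E] [BorelSpace E] :
    (Measure.pi fun _ : ι => stdGaussian E).map (WithLp.toLp 2) =
      stdGaussian (PiLp 2 fun _ : ι => E) := by
  have := FiniteDimensional.proper_real E
  have : IsProbabilityMeasure ((Measure.pi fun _ : ι => stdGaussian E).map (WithLp.toLp 2)) :=
    Measure.isProbabilityMeasure_map (by fun_prop)
  apply Measure.ext_of_charFun
  ext t
  simp_rw [charFun_stdGaussian, charFun_pi, charFun_stdGaussian, ← Complex.exp_sum,
    ← Complex.ofReal_pow, PiLp.norm_sq_eq_of_L2]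
  simp [Finset.sum_div, neg_div]

theorem hasLaw_rows_quatMatrix {Ω : Type*} [MeasurableSpace Ω] {P : Measure Ω}
    [IsProbabilityMeasure P] {m n : ℕ} {G : Fin 4 → Ω → Matrix (Fin m) (Fin n) ℝ}
    (hlaw : ∀ (c : Fin 4) (i : Fin m) (j : Fin n),
      HasLaw (fun ω => G c ω i j) (gaussianReal 0 1) P)
    (hindep : iIndepFun
      (fun (k : Fin 4 × Fin m × Fin n) (ω : Ω) => G k.1 ω k.2.1 k.2.2) P) :
    HasLaw (fun ω (i : Fin m) => (WithLp.toLp 2 (quatMatrix (fun c => G c ω) i) : QuatRow n))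
      (Measure.pi fun _ => stdGaussian (QuatRow n)) P := by
  have hm : ∀ k : Fin 4 × Fin m × Fin n, AEMeasurable (fun ω => G k.1 ω k.2.1 k.2.2) P :=
    fun k => (hlaw _ _ _).aemeasurable
  have h1 := (iIndepFun_iff_map_fun_eq_pi_map hm).1 hindep
  simp_rw [fun k : Fin 4 × Fin m × Fin n => (hlaw k.1 k.2.1 k.2.2).map_eq] at h1
  have hX : AEMeasurable (fun ω (k : Fin 4 × Fin m × Fin n) => G k.1 ω k.2.1 k.2.2) P :=
    aemeasurable_pi_lambda _ hm
  have h2 : Measurable fun x : Fin 4 × Fin m × Fin n → ℝ =>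
      (realEntriesEquivRows m n (WithLp.toLp 2 x)).ofLp :=
    (WithLp.measurable_ofLp 2 _).comp
      ((realEntriesEquivRows m n).continuous.measurable.comp (WithLp.measurable_toLp 2 _))
  have h3 : (Measure.pi fun _ : Fin 4 × Fin m × Fin n => gaussianReal 0 1).map (fun x =>
      (realEntriesEquivRows m n (WithLp.toLp 2 x)).ofLp) =
      Measure.pi fun _ : Fin m => stdGaussian (QuatRow n) := by
    have h4 := map_pi_stdGaussian (ι := Fin m) (E := QuatRow n)
    rw [← stdGaussian_map (realEntriesEquivRows m n), ← map_pi_eq_stdGaussian,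
      Measure.map_map (realEntriesEquivRows m n).continuous.measurable (by fun_prop)] at h4
    have h5 := congrArg (Measure.map (WithLp.ofLp (p := 2))) h4
    rw [Measure.map_map (by fun_prop) (by fun_prop), Measure.map_map (by fun_prop)
      ((realEntriesEquivRows m n).continuous.measurable.comp (by fun_prop))] at h5
    refine Eq.trans ?_ (h5.symm.trans ?_)
    · rfl
    · exact Measure.map_id
  constructor
  · exact h2.comp_aemeasurable hX
  · rw [← h3, ← h1, AEMeasurable.map_map_of_aemeasurable h2.aemeasurable hX]
    rfl

/-! ### Columns of the pseudoinverse and distances between rows -/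

/-- The distance from the `i`-th of finitely many quaternion rows to the left span of the others. -/
noncomputable def rowDist {m n : ℕ} (r : Fin (m + 1) → QuatRow n) (i : Fin (m + 1)) : ENNReal :=
  Metric.infEDist (r i) (Submodule.span ℍ (Set.range fun k : Fin m => r (i.succAbove k)))

theorem linearIndependent_of_rowDist_ne_zero {m n : ℕ} {r : Fin (m + 1) → QuatRow n}
    (h : ∀ i, rowDist r i ≠ 0) : LinearIndependent ℍ r := by
  rw [linearIndependent_iff_notMem_span]
  intro i hi
  apply h i
  have hs : Set.range (fun k : Fin m => r (i.succAbove k)) = r '' (Set.univ \ {i}) := by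
    rw [show (fun k : Fin m => r (i.succAbove k)) = r ∘ i.succAbove from rfl, Set.range_comp,
      Fin.range_succAbove, Set.compl_eq_univ_sdiff]
  rw [rowDist, hs]
  exact Metric.infEDist_zero_of_mem hi

/-- Since `(A * X - 1) * A = 0`, each row of `A * X - 1` gives a vanishing left combination of the
rows of `A`. -/
theorem mul_pinv_eq_one_of_linearIndependent {m n : ℕ} {r : Fin m → QuatRow n}
    (h : LinearIndependent ℍ r) {X : Matrix (Fin n) (Fin m) ℍ}
    (hX : IsMoorePenrose (Matrix.of fun i j => r i j) X) :
    (Matrix.of fun i j => r i j) * X = 1 := by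
  have h0 : ((Matrix.of fun i j => r i j) * X - 1) * (Matrix.of fun i j => r i j) = 0 := by
    rw [Matrix.sub_mul, hX.mul_mul_self, Matrix.one_mul, sub_self]
  rw [← sub_eq_zero]
  ext1 i k
  refine Fintype.linearIndependent_iff.1 h
    (((Matrix.of fun i j => r i j) * X - 1 : Matrix (Fin m) (Fin m) ℍ) i) ?_ k
  ext1 j
  have := congrFun (congrFun h0 i) j
  rw [Matrix.mul_apply] at this
  simpa using this

/-- Column `i` of `X` pairs to `1` with row `i` and to `0` with the others, so Cauchy–Schwarz bounds
the distance below; its conjugate lies in the row space, which gives equality. -/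
theorem rowDist_eq_inv_enorm_column {m n : ℕ} {r : Fin (m + 1) → QuatRow n}
    {X : Matrix (Fin n) (Fin (m + 1)) ℍ}
    (hX : IsMoorePenrose (Matrix.of fun i j => r i j) X)
    (h1 : (Matrix.of fun i j => r i j) * X = 1) (i : Fin (m + 1)) :
    rowDist r i = ‖(WithLp.toLp 2 fun j => X j i : QuatRow n)‖ₑ⁻¹ := by
  set A : Matrix (Fin (m + 1)) (Fin n) ℍ := Matrix.of fun i j => r i j with hA
  set x : QuatRow n := WithLp.toLp 2 fun j => X j i with hx
  have hcol : ∀ k, ∑ j, r k j * X j i = (1 : Matrix (Fin (m + 1)) (Fin (m + 1)) ℍ) k i :=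
    fun k => by rw [← h1, Matrix.mul_apply]; rfl
  have hx0 : x ≠ 0 := by
    intro hx0
    have h2 := hcol i
    have h3 : ∀ j, X j i = 0 := fun j => congrFun (congrArg WithLp.ofLp hx0) j
    simp [h3] at h2
  have hlow : ∀ y ∈ Submodule.span ℍ (Set.range fun k : Fin m => r (i.succAbove k)),
      1 ≤ ‖r i - y‖ * ‖x‖ := by
    intro y hy
    obtain ⟨d, rfl⟩ := (Submodule.mem_span_range_iff_exists_fun ℍ).1 hy
    have h2 : ∑ j, (r i - ∑ k, d k • r (i.succAbove k)) j * X j i = 1 := by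
      simp only [PiLp.sub_apply, WithLp.ofLp_sum, Finset.sum_apply, PiLp.smul_apply, smul_eq_mul,
        sub_mul, Finset.sum_mul, Finset.sum_sub_distrib, mul_assoc]
      rw [Finset.sum_comm]
      simp only [← Finset.mul_sum, hcol]
      simp
    calc (1 : ℝ) = ‖∑ j, (r i - ∑ k, d k • r (i.succAbove k)) j * X j i‖ := by rw [h2]; simp
      _ ≤ ∑ j, ‖(r i - ∑ k, d k • r (i.succAbove k)) j‖ * ‖X j i‖ :=
        (norm_sum_le _ _).trans (Finset.sum_le_sum fun j _ => (norm_mul _ _).le)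
      _ ≤ _ := by
        rw [PiLp.norm_eq_of_L2, PiLp.norm_eq_of_L2]
        exact Real.sum_mul_le_sqrt_mul_sqrt _ _ _
  -- Since `Xᴴ * X * A = Xᴴ`, the conjugated column is a left combination of the rows, in which row
  -- `i` has coefficient `‖x‖²`.
  have hstar : ∀ j, ∑ k, (Xᴴ * X) i k * r k j = star (X j i) := by
    intro j
    have h2 : Xᴴ * X * A = Xᴴ := by
      rw [Matrix.mul_assoc, ← hX.right_hermitian, ← Matrix.conjTranspose_mul, hX.self_mul_mul]
    have h3 := congrFun (congrFun h2 i) j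
    rw [Matrix.mul_apply] at h3
    exact h3
  have hdiag : (Xᴴ * X) i i = ((‖x‖ ^ 2 : ℝ) : ℍ) := by
    rw [Matrix.mul_apply, PiLp.norm_sq_eq_of_L2]
    refine Eq.trans ?_ (map_sum (algebraMap ℝ ℍ) (fun j => ‖x j‖ ^ 2) Finset.univ).symm
    refine Finset.sum_congr rfl fun j _ => ?_
    rw [Matrix.conjTranspose_apply, Quaternion.star_mul_self, Quaternion.normSq_eq_norm_mul_self,
      ← sq]
    rfl
  have hxn : 0 < ‖x‖ := norm_pos_iff.2 hx0
  obtain ⟨y, hy, hyn⟩ : ∃ y ∈ Submodule.span ℍ (Set.range fun k : Fin m => r (i.succAbove k)),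
      ‖r i - y‖ = ‖x‖⁻¹ := by
    -- Dividing that combination by `‖x‖²` gives row `i` coefficient `1`; what is left is the
    -- nearest point of the span.
    refine ⟨r i - (‖x‖ ^ 2)⁻¹ • WithLp.toLp 2 (fun j => star (X j i)), ?_, ?_⟩
    · refine (Submodule.mem_span_range_iff_exists_fun ℍ).2
        ⟨fun k => -((‖x‖ ^ 2)⁻¹ • (Xᴴ * X) i (i.succAbove k)), ?_⟩
      ext1 j
      have h2 := hstar j
      rw [Fin.sum_univ_succAbove _ i, hdiag] at h2
      simp only [WithLp.ofLp_sum, Finset.sum_apply, PiLp.smul_apply, smul_eq_mul, PiLp.sub_apply,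
        neg_mul, Finset.sum_neg_distrib, smul_mul_assoc, ← Finset.smul_sum]
      rw [← h2, smul_add, Quaternion.coe_mul_eq_smul, smul_smul, inv_mul_cancel₀ (by positivity),
        one_smul]
      exact (sub_add_cancel_left _ _).symm
    · rw [sub_sub_cancel, norm_smul]
      have h2 : ‖(WithLp.toLp 2 (fun j => star (X j i)) : QuatRow n)‖ = ‖x‖ := by
        rw [PiLp.norm_eq_of_L2, PiLp.norm_eq_of_L2]
        simp [hx]
      rw [h2, norm_inv, norm_pow, norm_norm]
      field_simp
  have he : ‖x‖ₑ⁻¹ = ENNReal.ofReal ‖x‖⁻¹ := by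
    rw [ENNReal.ofReal_inv_of_pos hxn, ofReal_norm]
  rw [he]
  apply le_antisymm
  · refine (Metric.infEDist_le_edist_of_mem hy).trans ?_
    rw [edist_dist, dist_eq_norm, hyn]
  · refine Metric.le_infEDist.2 fun z hz => ?_
    rw [edist_dist, dist_eq_norm]
    refine ENNReal.ofReal_le_ofReal ?_
    rw [inv_le_iff_one_le_mul₀ hxn]
    exact hlow z hz

theorem enorm_quatPinv_sq_eq_sum {m n : ℕ} {r : Fin (m + 1) → QuatRow n}
    (h : LinearIndependent ℍ r) :
    ‖quatPinv (Matrix.of fun i j => r i j)‖ₑ ^ 2 = ∑ i, (rowDist r i ^ 2)⁻¹ := by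
  have hX := quatPinv_isMoorePenrose (Matrix.of fun i j => r i j)
  have h1 := mul_pinv_eq_one_of_linearIndependent h hX
  generalize quatPinv (Matrix.of fun i j => r i j) = X at hX h1
  simp_rw [rowDist_eq_inv_enorm_column hX h1, ENNReal.inv_pow, inv_inv, ← ofReal_norm,
    ← ENNReal.ofReal_pow (norm_nonneg _)]
  rw [← ENNReal.ofReal_sum_of_nonneg (fun _ _ => by positivity)]
  congr 1
  simp_rw [PiLp.norm_sq_eq_of_L2]
  rw [Finset.sum_comm, Matrix.frobenius_norm_def, ← Real.sqrt_eq_rpow, Real.sq_sqrt (by positivity)]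
  simp

/-! ### Expected inverse square distances and almost sure independence -/

/-- The distance is an infimum of continuous functions over an uncountable set of coefficients;
upper semicontinuity survives such an infimum and gives measurability. -/
theorem measurable_infEDist_span (m n : ℕ) :
    Measurable fun z : QuatRow n × (Fin m → QuatRow n) =>
      Metric.infEDist z.1 (Submodule.span ℍ (Set.range z.2) : Set (QuatRow n)) := by
  have h : ∀ z : QuatRow n × (Fin m → QuatRow n),
      Metric.infEDist z.1 (Submodule.span ℍ (Set.range z.2) : Set (QuatRow n)) =
        ⨅ c : Fin m → ℍ, edist z.1 (∑ k, c k • z.2 k) := by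
    intro z
    apply le_antisymm
    · exact le_iInf fun c => Metric.infEDist_le_edist_of_mem
        ((Submodule.mem_span_range_iff_exists_fun ℍ).2 ⟨c, rfl⟩)
    · refine Metric.le_infEDist.2 fun y hy => ?_
      obtain ⟨c, rfl⟩ := (Submodule.mem_span_range_iff_exists_fun ℍ).1 hy
      exact iInf_le _ c
  simp_rw [h]
  refine (upperSemicontinuous_iInf fun c => Continuous.upperSemicontinuous ?_).measurable
  exact continuous_fst.edist (by fun_prop)

theorem measurable_rowDist {m n : ℕ} (i : Fin (m + 1)) :
    Measurable fun r : Fin (m + 1) → QuatRow n => rowDist r i :=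
  (measurable_infEDist_span m n).comp
    (f := fun r : Fin (m + 1) → QuatRow n => (r i, fun k => r (i.succAbove k))) (by fun_prop)

theorem finrank_span_range_le {m n : ℕ} (f : Fin m → QuatRow n) :
    Module.finrank ℍ (Submodule.span ℍ (Set.range f)) ≤ m :=
  (finrank_range_le_card f).trans_eq (Fintype.card_fin m)

/-- The actual rank of `f` is kept, so that this can serve to prove independence rather than
presuppose it. -/
theorem lintegral_inv_infEDist_span_sq {m n : ℕ} (hmn : m < n) (f : Fin m → QuatRow n) :
    ∫⁻ x, (Metric.infEDist x (Submodule.span ℍ (Set.range f) : Set (QuatRow n)) ^ 2)⁻¹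
        ∂stdGaussian (QuatRow n) =
      ENNReal.ofReal
        (1 / (4 * ((n : ℝ) - Module.finrank ℍ (Submodule.span ℍ (Set.range f))) - 2)) := by
  have h1 := finrank_span_range_le f
  have h2 := Module.finrank_mul_finrank ℝ ℍ (Submodule.span ℍ (Set.range f))
  rw [Quaternion.finrank_eq_four] at h2
  have h3 := lintegral_inv_infEDist_sq_stdGaussian
    ((Submodule.span ℍ (Set.range f)).restrictScalars ℝ) (by
      rw [finrank_quatRow]
      change Module.finrank ℝ (Submodule.span ℍ (Set.range f)) + 3 ≤ _
      omega)
  rw [finrank_quatRow] at h3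
  refine h3.trans ?_
  change ENNReal.ofReal (1 / (((4 * n : ℕ) : ℝ) -
    (Module.finrank ℝ (Submodule.span ℍ (Set.range f)) : ℝ) - 2)) = _
  rw [← h2]
  push_cast
  congr 3
  ring

theorem lintegral_inv_rowDist_sq {m n : ℕ} (hmn : m < n) (i : Fin (m + 1)) :
    ∫⁻ r, (rowDist r i ^ 2)⁻¹ ∂(Measure.pi fun _ : Fin (m + 1) => stdGaussian (QuatRow n)) =
      ∫⁻ f : Fin m → QuatRow n, ENNReal.ofReal
        (1 / (4 * ((n : ℝ) - Module.finrank ℍ (Submodule.span ℍ (Set.range f))) - 2))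
        ∂(Measure.pi fun _ => stdGaussian (QuatRow n)) := by
  have hm : Measurable fun z : QuatRow n × (Fin m → QuatRow n) =>
      (Metric.infEDist z.1 (Submodule.span ℍ (Set.range z.2) : Set (QuatRow n)) ^ 2)⁻¹ :=
    ((measurable_infEDist_span m n).pow_const 2).inv
  have h := (measurePreserving_piFinSuccAbove
    (fun _ : Fin (m + 1) => stdGaussian (QuatRow n)) i).lintegral_comp hm
  refine Eq.trans ?_ (h.trans ?_)
  · rfl
  · rw [lintegral_prod_symm _ hm.aemeasurable]
    exact lintegral_congr fun f => lintegral_inv_infEDist_span_sq hmn f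

/-- A zero distance would make its inverse square infinite, which a finite integral allows only on a
null set. -/
theorem ae_linearIndependent_rows {m n : ℕ} (hmn : m ≤ n) :
    ∀ᵐ r ∂(Measure.pi fun _ : Fin m => stdGaussian (QuatRow n)), LinearIndependent ℍ r := by
  rcases m with _ | m
  · exact Filter.Eventually.of_forall fun r => linearIndependent_empty_type
  have h : ∀ i : Fin (m + 1), ∀ᵐ r ∂(Measure.pi fun _ : Fin (m + 1) => stdGaussian (QuatRow n)),
      rowDist r i ≠ 0 := by
    intro i
    have hfin : ∫⁻ r, (rowDist r i ^ 2)⁻¹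
        ∂(Measure.pi fun _ : Fin (m + 1) => stdGaussian (QuatRow n)) ≠ ⊤ := by
      rw [lintegral_inv_rowDist_sq hmn]
      -- The other rows have rank at most `m < n`, so the denominator is at least `4 - 2 = 2`.
      refine ne_top_of_le_ne_top (b := ENNReal.ofReal (1 / 2)) ENNReal.ofReal_ne_top ?_
      refine (lintegral_mono (g := fun _ => ENNReal.ofReal (1 / 2)) fun f => ?_).trans_eq
        (by simp)
      refine ENNReal.ofReal_le_ofReal (one_div_le_one_div_of_le two_pos ?_)
      have h1 := finrank_span_range_le f
      have h2 : ((Module.finrank ℍ (Submodule.span ℍ (Set.range f)) + 1 : ℕ) : ℝ) ≤ n := by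
        exact_mod_cast (Nat.succ_le_succ h1).trans hmn
      push_cast at h2
      linarith
    filter_upwards [ae_lt_top ((measurable_rowDist i).pow_const 2).inv hfin] with r hr h0
    simp [h0] at hr
  filter_upwards [ae_all_iff.2 h] with r hr
  exact linearIndependent_of_rowDist_ne_zero hr

theorem lintegral_enorm_quatPinv_sq {m n : ℕ} (hmn : m ≤ n) :
    ∫⁻ r, ‖quatPinv (Matrix.of fun i j => r i j)‖ₑ ^ 2
        ∂(Measure.pi fun _ : Fin m => stdGaussian (QuatRow n)) =
      ENNReal.ofReal ((m : ℝ) / (4 * ((n : ℝ) - m) + 2)) := by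
  rcases m with _ | m
  · have h : ∀ X : Matrix (Fin n) (Fin 0) ℍ, X = 0 := fun X => Subsingleton.elim _ _
    simp [h]
  have hn : (m + 1 : ℝ) ≤ n := by exact_mod_cast hmn
  -- There are now `m + 1` rows, `m` of them other than row `i`; `4(n-m) - 2` equals `4(n-(m+1)) +
  -- 2`.
  have hrow : ∀ i : Fin (m + 1), ∫⁻ r, (rowDist r i ^ 2)⁻¹
      ∂(Measure.pi fun _ : Fin (m + 1) => stdGaussian (QuatRow n)) =
        ENNReal.ofReal (1 / (4 * ((n : ℝ) - m) - 2)) := by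
    intro i
    rw [lintegral_inv_rowDist_sq hmn]
    have h : ∀ᵐ f ∂(Measure.pi fun _ : Fin m => stdGaussian (QuatRow n)), ENNReal.ofReal
        (1 / (4 * ((n : ℝ) - Module.finrank ℍ (Submodule.span ℍ (Set.range f))) - 2)) =
        ENNReal.ofReal (1 / (4 * ((n : ℝ) - m) - 2)) := by
      filter_upwards [ae_linearIndependent_rows (by omega : m ≤ n)] with f hf
      rw [finrank_span_eq_card hf, Fintype.card_fin]
    rw [lintegral_congr_ae h]
    simp
  rw [lintegral_congr_ae ((ae_linearIndependent_rows hmn).mono fun r hr =>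
    enorm_quatPinv_sq_eq_sum hr), lintegral_finsetSum (f := fun i r => (rowDist r i ^ 2)⁻¹)
      _ fun i _ => ((measurable_rowDist i).pow_const 2).inv]
  simp_rw [hrow]
  rw [← ENNReal.ofReal_sum_of_nonneg fun _ _ => one_div_nonneg.2 (by linarith)]
  simp only [Finset.sum_const, Finset.card_univ, Fintype.card_fin, nsmul_eq_mul]
  congr 1
  push_cast
  rw [mul_one_div]
  congr 1
  ring

/-- `quatPinv` is obtained by choice, so measurability is borrowed from the sum over row distances,
which agrees with it almost everywhere. -/
theorem aemeasurable_enorm_quatPinv_sq {m n : ℕ} (hmn : m ≤ n) :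
    AEMeasurable (fun r : Fin m → QuatRow n => ‖quatPinv (Matrix.of fun i j => r i j)‖ₑ ^ 2)
      (Measure.pi fun _ => stdGaussian (QuatRow n)) := by
  rcases m with _ | m
  · have h : ∀ X : Matrix (Fin n) (Fin 0) ℍ, X = 0 := fun X => Subsingleton.elim _ _
    simp [h]
  refine ⟨fun r => ∑ i, (rowDist r i ^ 2)⁻¹,
    Finset.measurable_fun_sum _ fun i _ => ((measurable_rowDist i).pow_const 2).inv, ?_⟩
  exact (ae_linearIndependent_rows hmn).mono fun r hr => enorm_quatPinv_sq_eq_sum hr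

theorem mainTheorem4 {Ω : Type*} [MeasurableSpace Ω] (P : Measure Ω) [IsProbabilityMeasure P]
    (m n : ℕ) (hmn : m ≤ n)
    (G : Fin 4 → Ω → Matrix (Fin m) (Fin n) ℝ)
    (hlaw : ∀ (c : Fin 4) (i : Fin m) (j : Fin n),
      HasLaw (fun ω => G c ω i j) (gaussianReal 0 1) P)
    (hindep : iIndepFun
      (fun (k : Fin 4 × Fin m × Fin n) (ω : Ω) => G k.1 ω k.2.1 k.2.2) P) :
    Integrable (fun ω => ‖quatPinv (quatMatrix fun c => G c ω)‖ ^ 2) P ∧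
      ∫ ω, ‖quatPinv (quatMatrix fun c => G c ω)‖ ^ 2 ∂P =
        (m : ℝ) / (4 * ((n : ℝ) - (m : ℝ)) + 2) := by
  have hrows := hasLaw_rows_quatMatrix hlaw hindep
  have hm0 := aemeasurable_enorm_quatPinv_sq hmn
  have hl0 := lintegral_enorm_quatPinv_sq hmn
  rw [← hrows.map_eq] at hm0 hl0
  rw [lintegral_map' hm0 hrows.aemeasurable] at hl0
  have hm : AEMeasurable (fun ω => ‖quatPinv (quatMatrix fun c => G c ω)‖ₑ ^ 2) P :=
    hm0.comp_aemeasurable hrows.aemeasurable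
  have hl : ∫⁻ ω, ‖quatPinv (quatMatrix fun c => G c ω)‖ₑ ^ 2 ∂P =
      ENNReal.ofReal ((m : ℝ) / (4 * ((n : ℝ) - m) + 2)) := hl0
  have htop : ∫⁻ ω, ‖quatPinv (quatMatrix fun c => G c ω)‖ₑ ^ 2 ∂P ≠ ⊤ := by
    rw [hl]
    exact ENNReal.ofReal_ne_top
  have hreal : ∀ ω, ‖quatPinv (quatMatrix fun c => G c ω)‖ ^ 2 =
      (‖quatPinv (quatMatrix fun c => G c ω)‖ₑ ^ 2).toReal := fun ω => by
    rw [ENNReal.toReal_pow, toReal_enorm]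
  simp_rw [hreal]
  refine ⟨integrable_toReal_of_lintegral_ne_top hm htop, ?_⟩
  rw [integral_toReal hm (ae_lt_top' hm htop), hl, ENNReal.toReal_ofReal]
  have hn : (m : ℝ) ≤ n := by exact_mod_cast hmn
  exact div_nonneg (Nat.cast_nonneg m) (by linarith)
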